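/- All rings are commutative with identity and all modules are unitary. For a ring $R$, let $\mathrm{Nil}(R)$ be its nilradical and $\mathrm{T}(R)$ its total ring of fractions; an ideal is called nonnil if it is not contained in $\mathrm{Nil}(R)$. A $\phi$-ring is a ring $R$ such that $\mathrm{Nil}(R)$ is a prime ideal with $\mathrm{Nil}(R)\subsetneq (x)$ for every $x\in R\setminus \mathrm{Nil}(R)$; it is a strong $\phi$-ring if moreover the set of zero-divisors of $R$ equals $\mathrm{Nil}(R)$. For a $\phi$-ring $R$, let $\phi:\mathrm{T}(R)\to R_{\mathrm{Nil}(R)}$ be the ring homomorphism $a/b\mapsto a/b$, and let $\phi(R)$ be the image of $R$ under it. A $\phi$-ring $R$ is $\phi$-Dedekind if for every nonnil ideal $I$ of $R$ the ideal $\phi(I)$ of $\phi(R)$ is invertible, where an ideal $J$ of a ring $A$ is invertible if it contains a regular element and $JJ^{-1}=A$ with $J^{-1}=\{x\in \mathrm{T}(A)\mid Jx\subseteq A\}$. An $R$-module $T$ is $\phi$-torsion if every element of $T$ is annihilated by some nonnil ideal of $R$. An $R$-module $M$ is strongly nonnil-injective if $\mathrm{Ext}^n_R(T,M)=0$ for every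 $\phi$-torsion $R$-module $T$ and every $n\ge 1$. The $\phi$-injective dimension $\phi\text{-}\mathrm{id}_R(M)\in\mathbb{N}\cup\{\infty\}$ is the least $n\ge 0$ for which there is an exact sequence $0\to M\to E_0\to E_1\to\cdots\to E_n\to 0$ with all $E_i$ strongly nonnil-injective ($\infty$ if there is none), and $\phi\text{-}\mathrm{gl.dim}(R)=\sup\{\phi\text{-}\mathrm{id}_R(M)\mid M \text{ an } R\text{-module}\}$. **Theorem.** Let $R$ be a $\phi$-ring. The following statements are equivalent: 1. $\phi\text{-}\mathrm{gl.dim}(R)\leq 1$; 2. every quotient module of an injective $R$-module is strongly nonnil-injective; 3. every quotient module of a strongly nonnil-injective $R$-module is strongly nonnil-injective; 4. $R$ is a $\phi$-Dedekind ring and a strong $\phi$-ring. -/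

import Mathlib

universe u

namespace PhiRing

open CategoryTheory

section Rings

variable (R : Type u) [CommRing R]

/-- A `φ`-ring: the nilradical is a divided prime ideal, i.e. a prime ideal properly contained
in every principal ideal generated by an element outside of it. -/
class IsPhiRing : Prop where
  nilradical_isPrime : (nilradical R).IsPrime
  nilradical_lt_span : ∀ x : R, x ∉ nilradical R → nilradical R < Ideal.span {x}

instance [IsPhiRing R] : (nilradical R).IsPrime := IsPhiRing.nilradical_isPrime

/-- A `ZN`-ring: the set of zero-divisors equals the nilradical. -/
def IsZNRing : Prop :=
  {a : R | ∃ b : R, b ≠ 0 ∧ a * b = 0} = (nilradical R : Set R)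

/-- A strong `φ`-ring: a `φ`-ring which is a `ZN`-ring. -/
def IsStrongPhiRing : Prop := IsPhiRing R ∧ IsZNRing R

variable {R} in
/-- A nonnil ideal: an ideal not contained in the nilradical. -/
def IsNonnil (I : Ideal R) : Prop := ¬ I ≤ nilradical R

/-- Regular elements of a `φ`-ring lie outside the nilradical. -/
theorem nonZeroDivisors_le_primeCompl [IsPhiRing R] :
    nonZeroDivisors R ≤ (nilradical R).primeCompl := by
  intro a ha hnil
  have hne : (1 : R) ≠ 0 := fun h =>
    (IsPhiRing.nilradical_isPrime (R := R)).ne_top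
      ((Ideal.eq_top_iff_one _).2 (h ▸ (nilradical R).zero_mem))
  obtain ⟨n, hn⟩ := mem_nilradical.1 hnil
  have h0 : (0 : R) ∈ nonZeroDivisors R := hn ▸ pow_mem ha n
  exact hne ((mem_nonZeroDivisors_iff.1 h0).1 1 (zero_mul 1))

/-- The ring homomorphism `φ : T(R) → R_{Nil(R)}`, `a / b ↦ a / b`, from the total ring of
fractions of a `φ`-ring to its localization at the nilradical. -/
noncomputable def phi [IsPhiRing R] :
    FractionRing R →+* Localization.AtPrime (nilradical R) :=
  IsLocalization.lift (M := nonZeroDivisors R) (S := FractionRing R)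
    (g := algebraMap R (Localization.AtPrime (nilradical R))) fun b =>
      IsLocalization.map_units (Localization.AtPrime (nilradical R))
        (⟨b, nonZeroDivisors_le_primeCompl R b.2⟩ : (nilradical R).primeCompl)

/-- The restriction of `φ` to `R`. -/
noncomputable def phiRestrict [IsPhiRing R] : R →+* Localization.AtPrime (nilradical R) :=
  (phi R).comp (algebraMap R (FractionRing R))

theorem phiRestrict_eq_algebraMap [IsPhiRing R] :
    phiRestrict R = algebraMap R (Localization.AtPrime (nilradical R)) :=
  IsLocalization.lift_comp _

/-- The ring `φ(R)`, the image of `R` under `φ`. -/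
noncomputable abbrev phiRange [IsPhiRing R] : Subring (Localization.AtPrime (nilradical R)) :=
  (phiRestrict R).range

/-- An ideal `J` of a commutative ring `A` is invertible if it contains a regular element and
`J * J⁻¹ = A`, where `J⁻¹ = {x ∈ T(A) | J x ⊆ A}`; here `1 / J` is this submodule `J⁻¹` of the
total ring of fractions `T(A)`, and `1` is the image of `A` in `T(A)`. -/
def IsInvertibleIdeal {A : Type u} [CommRing A] (J : Ideal A) : Prop :=
  (∃ a ∈ J, a ∈ nonZeroDivisors A) ∧
    IsLocalization.coeSubmodule (FractionRing A) J *
      (1 / IsLocalization.coeSubmodule (FractionRing A) J) = 1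

variable {R} in
/-- An ideal `I` of a `φ`-ring is `φ`-invertible if `φ(I)` is an invertible ideal of `φ(R)`.
(`R → φ(R)` is onto, so `Ideal.map` is the image.) -/
def IsPhiInvertible [IsPhiRing R] (I : Ideal R) : Prop :=
  IsInvertibleIdeal (I.map (phiRestrict R).rangeRestrict)

/-- A `φ`-Dedekind ring: a `φ`-ring all of whose nonnil ideals are `φ`-invertible. -/
def IsPhiDedekindRing [IsPhiRing R] : Prop :=
  ∀ I : Ideal R, IsNonnil I → IsPhiInvertible I

end Rings

section Modules

variable (R : Type u) [CommRing R] (M : Type u) [AddCommGroup M] [Module R M]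

/-- `φ-tor(M)`, the set of elements annihilated by a nonnil ideal. -/
def phiTor : Set M := {x | ∃ I : Ideal R, IsNonnil I ∧ ∀ a ∈ I, a • x = 0}

/-- A `φ`-torsion module: `φ-tor(M) = M`. -/
def IsPhiTorsion : Prop := phiTor R M = Set.univ

/-- A strongly nonnil-injective module: `Ext^n_R(T, M) = 0` for every `φ`-torsion module `T` and
every `n ≥ 1`. -/
def IsStronglyNonnilInjective : Prop :=
  ∀ T : ModuleCat.{u} R, IsPhiTorsion R T → ∀ n : ℕ, 1 ≤ n →
    Subsingleton (Abelian.Ext.{u} T (ModuleCat.of R M) n)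

/-- There is an exact sequence `0 → M → E₀ → E₁ → ⋯ → Eₙ → 0` with all `Eᵢ` strongly
nonnil-injective (the sequence is continued by zero modules beyond `Eₙ`). -/
def HasPhiInjectiveResolution (n : ℕ) : Prop :=
  ∃ (E : ℕ → ModuleCat.{u} R) (ι : M →ₗ[R] E 0) (d : ∀ i, E i →ₗ[R] E (i + 1)),
    Function.Injective ι ∧ Function.Exact ι (d 0) ∧
    (∀ i, Function.Exact (d i) (d (i + 1))) ∧
    (∀ i ≤ n, IsStronglyNonnilInjective R (E i)) ∧
    ∀ i, n < i → Subsingleton (E i)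

/-- The `φ`-injective dimension: the least length of a finite `φ`-injective resolution, `⊤` if
there is none. -/
noncomputable def phiInjectiveDimension : ℕ∞ :=
  ⨅ (n : ℕ) (_ : HasPhiInjectiveResolution R M n), (n : ℕ∞)

/-- The `φ`-global dimension: the supremum of the `φ`-injective dimensions of all modules. -/
noncomputable def phiGlobalDimension : ℕ∞ :=
  ⨆ N : ModuleCat.{u} R, phiInjectiveDimension R N

end Modules

end PhiRing

/-! All four conditions say that every `φ`-torsion module has projective dimension at most one,
which amounts to every nonnil ideal being projective (`forall_hasProjectiveDimensionLE_one_iff`). If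
`I` is nonnil, `R ⧸ I` is `φ`-torsion with first syzygy `I`. Conversely, if `I` is projective, a map
from `I` to a quotient of an injective `E` lifts to `E` and extends to `R`; a Baer criterion
restricted to nonnil ideals then kills `Ext¹(T, E ⧸ N)`, and dimension shifting kills `Ext²(T, -)`.
On the ring side, projectivity of the principal nonnil ideals forces their generators to be regular,
so `R ≅ φ(R)`; and an ideal with a regular element is invertible exactly when it is projective. -/

namespace PhiRing

open CategoryTheory Abelian

/-! ### Invertible ideals and projective ideals -/

section Invertible

/-- An ideal containing a regular element is invertible iff it is projective. -/
theorem isInvertibleIdeal_iff_projective {A : Type u} [CommRing A] (J : Ideal A) :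
    IsInvertibleIdeal J ↔ (∃ a ∈ J, a ∈ nonZeroDivisors A) ∧ Module.Projective A J := by
  refine and_congr_right fun ⟨a, haJ, ha⟩ ↦ ⟨fun h ↦ ?_, fun h ↦ ?_⟩
  · have : Module.Projective A (Submodule.map (Algebra.linearMap A (FractionRing A)) J) :=
      Submodule.projective_of_isUnit (IsUnit.of_mul_eq_one _ h)
    exact Module.Projective.of_equiv' (Submodule.equivMapOfInjective
      (Algebra.linearMap A (FractionRing A)) (IsFractionRing.injective A (FractionRing A)) J).symm
  · obtain ⟨s, hs⟩ := Module.projective_def.1 h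
    have hinv : ∀ c : A, IsLocalization.mk' (FractionRing A) c ⟨a, ha⟩ *
        algebraMap A (FractionRing A) a = algebraMap A _ c :=
      fun c ↦ IsLocalization.mk'_spec (FractionRing A) c ⟨a, ha⟩
    have hu : IsUnit (algebraMap A (FractionRing A) a) :=
      IsLocalization.map_units (FractionRing A) (⟨a, ha⟩ : nonZeroDivisors A)
    -- Apply the section to `y • x = x • y`: each coordinate functional of the dual basis is
    -- multiplication by the fraction `s(a)_j / a`, which therefore lies in `J⁻¹`.
    have hcomm (x y j : J) : s x j * (y : A) = s y j * (x : A) := by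
      have h1 : (y : A) • x = (x : A) • y := Subtype.ext (mul_comm _ _)
      have h2 := DFunLike.congr_fun (congrArg s h1) j
      simpa [mul_comm] using h2
    refine le_antisymm (Submodule.mul_le.2 fun x hx y hy ↦ ?_) (Submodule.one_le.2 ?_)
    · rw [mul_comm]
      exact Submodule.mem_div_iff_forall_mul_mem.1 hy x hx
    -- Dividing the expansion `a = ∑ s(a)_j j` by `a` exhibits `1` in `J * J⁻¹`.
    · have h1 : (1 : FractionRing A) = (s ⟨a, haJ⟩).sum fun j c ↦
          algebraMap A (FractionRing A) j * IsLocalization.mk' (FractionRing A) c ⟨a, ha⟩ := by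
        have h2 : algebraMap A (FractionRing A) a =
            (s ⟨a, haJ⟩).sum fun j c ↦ algebraMap A (FractionRing A) (c * j) := by
          refine (congrArg (fun x : J ↦ algebraMap A (FractionRing A) x) (hs ⟨a, haJ⟩)).symm.trans ?_
          simp [Finsupp.linearCombination_apply, Finsupp.sum]
        refine hu.mul_left_injective ?_
        simp only [one_mul, Finsupp.sum, Finset.sum_mul]
        refine h2.trans <| Finset.sum_congr rfl fun j _ ↦ ?_
        rw [mul_assoc, hinv, ← map_mul, mul_comm (j : A)]
      rw [h1]
      refine Submodule.sum_mem _ fun j _ ↦ Submodule.mul_mem_mul ⟨j, j.2, rfl⟩ ?_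
      refine Submodule.mem_div_iff_forall_mul_mem.2 ?_
      rintro _ ⟨x, hx, rfl⟩
      refine Submodule.mem_one.2 ⟨s ⟨x, hx⟩ j, hu.mul_left_injective ?_⟩
      simp only [Algebra.linearMap_apply]
      rw [mul_right_comm, hinv, ← map_mul, ← map_mul]
      exact congrArg _ (hcomm ⟨x, hx⟩ ⟨a, haJ⟩ j)

attribute [local instance] RingHomInvPair.of_ringEquiv in
/-- The semilinear equivalence between an ideal and its image under a ring isomorphism. -/
noncomputable def idealMapEquiv {A B : Type u} [CommRing A] [CommRing B] (e : A ≃+* B)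
    (I : Ideal A) : I ≃ₛₗ[(e : A →+* B)] I.map (e : A →+* B) where
  toFun x := ⟨e x, Ideal.mem_map_of_mem _ x.2⟩
  invFun y := ⟨e.symm y, by
    obtain ⟨x, hx, h⟩ := (Ideal.mem_map_iff_of_surjective (e : A →+* B) e.surjective).1 y.2
    rw [← h]
    simpa using hx⟩
  map_add' _ _ := Subtype.ext (map_add e _ _)
  map_smul' _ _ := Subtype.ext (map_mul e _ _)
  left_inv _ := by simp
  right_inv _ := by simp

attribute [local instance] RingHomInvPair.of_ringEquiv in
theorem projective_map_ringEquiv_iff {A B : Type u} [CommRing A] [CommRing B] (e : A ≃+* B)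
    (I : Ideal A) : Module.Projective B (I.map (e : A →+* B)) ↔ Module.Projective A I :=
  ⟨fun _ ↦ Module.Projective.of_equiv (idealMapEquiv e I).symm,
    fun _ ↦ Module.Projective.of_equiv (idealMapEquiv e I)⟩

end Invertible

/-! ### Nonnil ideals of a `φ`-ring -/

section Rings

variable {R : Type u} [CommRing R]

theorem isNonnil_iff {I : Ideal R} : IsNonnil I ↔ ∃ a ∈ I, a ∉ nilradical R :=
  SetLike.not_le_iff_exists

variable [IsPhiRing R]

/-- A ZN `φ`-ring: elements outside of the nilradical are regular. -/
theorem isZNRing_iff :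
    IsZNRing R ↔ ∀ a : R, a ∉ nilradical R → a ∈ nonZeroDivisors R := by
  have key (a : R) : (∃ b : R, b ≠ 0 ∧ a * b = 0) ↔ a ∉ nonZeroDivisors R := by
    rw [mem_nonZeroDivisors_iff_left]
    push Not
    exact ⟨fun ⟨b, h, h'⟩ ↦ ⟨b, h', h⟩, fun ⟨b, h, h'⟩ ↦ ⟨b, h', h⟩⟩
  rw [IsZNRing, Set.ext_iff]
  simp only [Set.mem_ofPred_eq, key, SetLike.mem_coe]
  exact ⟨fun h a ha ↦ not_not.1 fun h' ↦ ha ((h a).1 h'), fun h a ↦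
    ⟨fun h' ↦ not_not.1 fun ha ↦ h' (h a ha), fun ha h' ↦ nonZeroDivisors_le_primeCompl R h' ha⟩⟩

theorem rangeRestrict_phiRestrict_bijective (h : IsZNRing R) :
    Function.Bijective (phiRestrict R).rangeRestrict := by
  refine ⟨?_, (phiRestrict R).rangeRestrict_surjective⟩
  have hinj : Function.Injective (phiRestrict R) := by
    rw [phiRestrict_eq_algebraMap]
    exact IsLocalization.injective (M := (nilradical R).primeCompl) _ fun a ha ↦ isZNRing_iff.1 h a ha
  exact fun x y hxy ↦ hinj (congrArg Subtype.val hxy)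

/-- Over a strong `φ`-ring, the `φ`-invertible nonnil ideals are the projective ones. -/
theorem isPhiInvertible_iff_projective (h : IsZNRing R) {I : Ideal R} (hI : IsNonnil I) :
    IsPhiInvertible I ↔ Module.Projective R I := by
  let e := RingEquiv.ofBijective _ (rangeRestrict_phiRestrict_bijective h)
  have he : (e : R →+* phiRange R) = (phiRestrict R).rangeRestrict := rfl
  obtain ⟨a, haI, ha⟩ := isNonnil_iff.1 hI
  rw [IsPhiInvertible, isInvertibleIdeal_iff_projective, ← he, projective_map_ringEquiv_iff]
  refine and_iff_right ⟨e a, Ideal.mem_map_of_mem _ haI, ?_⟩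
  refine mem_nonZeroDivisors_iff_right.2 fun b hb ↦ ?_
  have := mem_nonZeroDivisors_iff_right.1 (isZNRing_iff.1 h a ha) (e.symm b)
    (e.injective (by simpa using hb))
  simpa using this

/-- Splitting `R → (a)` gives an idempotent `e` with `e * a = a` that is killed by the annihilator
of `a`. As the nilradical is prime, `e` or `1 - e` is nilpotent: the first would give `a = 0`, the
second makes `e` a unit, so the annihilator vanishes. -/
theorem mem_nonZeroDivisors_of_projective_span {a : R} (ha : a ∉ nilradical R)
    [Module.Projective R (Ideal.span {a})] : a ∈ nonZeroDivisors R := by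
  have haI : a ∈ Ideal.span {a} := Ideal.mem_span_singleton_self a
  obtain ⟨s, hs⟩ := Module.projective_lifting_property
    (LinearMap.toSpanSingleton R (Ideal.span {a}) ⟨a, haI⟩) LinearMap.id (by
      rintro ⟨x, hx⟩
      obtain ⟨r, rfl⟩ := Ideal.mem_span_singleton'.1 hx
      exact ⟨r, rfl⟩)
  set e := s ⟨a, haI⟩
  have hea : e * a = a := congrArg Subtype.val (LinearMap.congr_fun hs ⟨a, haI⟩)
  have hann (b : R) (hb : b * a = 0) : b * e = 0 := by
    rw [← smul_eq_mul, ← map_smul]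
    convert map_zero s
    exact Subtype.ext hb
  have hee : (1 - e) * e = 0 := hann _ (by rw [sub_mul, hea, one_mul, sub_self])
  rcases (IsPhiRing.nilradical_isPrime (R := R)).mem_or_mem (hee ▸ zero_mem _) with h | h
  · have hu : IsUnit e := by simpa using (mem_nilradical.1 h).isUnit_one_sub
    exact mem_nonZeroDivisors_iff_right.2 fun b hb ↦ hu.mul_left_eq_zero.1 (hann b hb)
  · have hu : IsUnit (1 - e) := (mem_nilradical.1 h).isUnit_one_sub
    have : (1 - e) * a = 0 := by rw [sub_mul, hea, one_mul, sub_self]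
    exact absurd (hu.mul_right_eq_zero.1 this ▸ zero_mem _) ha

/-- A `φ`-ring is strong and `φ`-Dedekind iff its nonnil ideals are projective. -/
theorem isPhiDedekindRing_and_isStrongPhiRing_iff :
    IsPhiDedekindRing R ∧ IsStrongPhiRing R ↔
      ∀ I : Ideal R, IsNonnil I → Module.Projective R I := by
  refine ⟨fun ⟨hD, _, hZ⟩ I hI ↦ (isPhiInvertible_iff_projective hZ hI).1 (hD I hI), fun h ↦ ?_⟩
  have hZ : IsZNRing R := isZNRing_iff.2 fun a ha ↦
    have := h (Ideal.span {a}) (isNonnil_iff.2 ⟨a, Ideal.mem_span_singleton_self a, ha⟩)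
    mem_nonZeroDivisors_of_projective_span ha
  exact ⟨fun I hI ↦ (isPhiInvertible_iff_projective hZ hI).2 (h I hI), inferInstance, hZ⟩

end Rings

/-! ### Baer's criterion for nonnil ideals -/

section Extension

variable {R : Type u} [CommRing R]

/-- Baer's criterion relative to a class of ideals: if linear maps into `Q` extend along `I ⊆ R`
for every nonnil ideal `I`, they extend along every inclusion with `φ`-torsion cokernel. -/
theorem exists_extension_of_forall_isNonnil {Q P : Type u} [AddCommGroup Q] [Module R Q]
    [AddCommGroup P] [Module R P]
    (hQ : ∀ I : Ideal R, IsNonnil I → ∀ g : I →ₗ[R] Q, ∃ g' : R →ₗ[R] Q, g' ∘ₗ I.subtype = g)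
    (K : Submodule R P)
    (hK : ∀ y : P, ∃ I : Ideal R, IsNonnil I ∧ ∀ a ∈ I, a • y ∈ K) (f : K →ₗ[R] Q) :
    ∃ g : P →ₗ[R] Q, g ∘ₗ K.subtype = f := by
  have : Fact (Function.Injective K.subtype) := ⟨K.injective_subtype⟩
  let F := Module.Baer.extensionOfMax K.subtype f
  have hKF : K ≤ F.domain := by simpa using F.le
  have htop : F.domain = ⊤ := by
    refine Submodule.eq_top_iff'.2 fun y ↦ ?_
    let l : R →ₗ[R] P := LinearMap.toSpanSingleton R P y
    -- `J` consists of the `r` with `r • y` in the domain of the maximal extension `F`. Extending `r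
    -- ↦ F (r • y)` from `J` to `R` supplies the value `g' 1` to assign to `y`.
    let J : Ideal R := F.domain.comap l
    have hJ : IsNonnil J := by
      obtain ⟨I, hI, hIy⟩ := hK y
      exact fun h ↦ hI (le_trans (fun a ha ↦ hKF (hIy a ha)) h)
    obtain ⟨g', hg'⟩ := hQ J hJ (F.toFun ∘ₗ l.restrict (q := F.domain) fun _ h ↦ h)
    have hF (r : R) (hr : r • y ∈ F.domain) : r • g' 1 = F.toLinearPMap ⟨r • y, hr⟩ := by
      rw [← map_smul, smul_eq_mul, mul_one]
      exact LinearMap.congr_fun hg' ⟨r, hr⟩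
    let q : P →ₗ.[R] Q := LinearPMap.mkSpanSingleton' y (g' 1) fun c hc ↦ by
      have h0 : c • y ∈ F.domain := hc ▸ zero_mem _
      rw [RingHom.id_apply, hF c h0]
      exact (congrArg F.toLinearPMap (Subtype.ext hc)).trans F.toLinearPMap.map_zero
    have hcompat (x : F.domain) (z : q.domain) (h : (x : P) = z) : F.toLinearPMap x = q z := by
      obtain ⟨z, hz⟩ := z
      obtain ⟨c, rfl⟩ := Submodule.mem_span_singleton.1 hz
      obtain ⟨x, hx⟩ := x
      obtain rfl : x = c • y := h
      rw [← hF c hx]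
      exact (LinearPMap.mkSpanSingleton'_apply y (g' 1) _ c hz).symm
    let G : Module.Baer.ExtensionOf K.subtype f :=
      { F.toLinearPMap.sup q hcompat with
        le := F.le.trans (LinearPMap.left_le_sup _ _ hcompat).1
        is_extension := fun m ↦ (F.is_extension m).trans
          ((LinearPMap.left_le_sup _ _ hcompat).2 rfl) }
    have hFG : F ≤ G := LinearPMap.left_le_sup _ _ hcompat
    have hGF : G = F := Module.Baer.extensionOfMax_is_max _ _ G hFG
    have hy : y ∈ G.domain := (le_sup_right : q.domain ≤ F.domain ⊔ q.domain)
      (Submodule.mem_span_singleton_self y)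
    rwa [hGF] at hy
  refine ⟨F.toFun ∘ₗ (LinearEquiv.ofTop _ htop).symm.toLinearMap, LinearMap.ext fun x ↦ ?_⟩
  exact (F.is_extension x).symm

end Extension

/-! ### Projective dimension of `φ`-torsion modules -/

section Homological

variable {R : Type u} [CommRing R]

theorem isPhiTorsion_iff {T : Type u} [AddCommGroup T] [Module R T] :
    IsPhiTorsion R T ↔ ∀ x : T, ∃ I : Ideal R, IsNonnil I ∧ ∀ a ∈ I, a • x = 0 :=
  Set.eq_univ_iff_forall

theorem isPhiTorsion_quotient {I : Ideal R} (hI : IsNonnil I) : IsPhiTorsion R (R ⧸ I) := by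
  refine isPhiTorsion_iff.2 fun x ↦ ⟨I, hI, fun a ha ↦ ?_⟩
  obtain ⟨r, rfl⟩ := Submodule.mkQ_surjective I x
  rw [← map_smul, Submodule.mkQ_apply, Submodule.Quotient.mk_eq_zero, smul_eq_mul]
  exact I.mul_mem_right r ha

theorem isStronglyNonnilInjective_of_injective (E : Type u) [AddCommGroup E] [Module R E]
    [Module.Injective R E] : IsStronglyNonnilInjective R E := fun T _ n hn ↦ by
  obtain ⟨n, rfl⟩ := Nat.exists_eq_add_of_le' hn
  have := Module.injective_object_of_injective_module R E
  exact Ext.subsingleton_of_injective T (ModuleCat.of R E) n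

/-- `Ext¹(T, Q)` vanishes for `φ`-torsion `T` when `Q` satisfies Baer's criterion for nonnil
ideals. -/
theorem subsingleton_ext_one_of_forall_isNonnil {Q : Type u} [AddCommGroup Q] [Module R Q]
    (hQ : ∀ I : Ideal R, IsNonnil I → ∀ g : I →ₗ[R] Q, ∃ g' : R →ₗ[R] Q, g' ∘ₗ I.subtype = g)
    {T : ModuleCat.{u} R} (hT : IsPhiTorsion R T) :
    Subsingleton (Ext.{u} T (ModuleCat.of R Q) 1) := by
  let π : (T →₀ R) →ₗ[R] T := Finsupp.linearCombination R id
  have hπ : Function.Surjective π :=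
    Finsupp.linearCombination_surjective _ Function.surjective_id
  have hS := LinearMap.shortExact_shortComplexKer hπ
  have : Projective π.shortComplexKer.X₂ :=
    (IsProjective.iff_projective (R := R) (T →₀ R)).1 inferInstance
  refine subsingleton_of_forall_eq 0 fun x ↦ ?_
  obtain ⟨y, rfl⟩ := Ext.contravariant_sequence_exact₃ hS _ x (Ext.eq_zero_of_projective _)
    (add_zero 1)
  obtain ⟨f, rfl⟩ := (Ext.mk₀_bijective _ _).2 y
  -- The free cover modulo its kernel is `T`, hence `φ`-torsion, so `f` extends to the free module
  -- and its connecting image vanishes.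
  obtain ⟨g, hg⟩ := exists_extension_of_forall_isNonnil hQ (LinearMap.ker π) (fun y ↦ by
    obtain ⟨I, hI, h⟩ := isPhiTorsion_iff.1 hT (π y)
    exact ⟨I, hI, fun a ha ↦ by rw [LinearMap.mem_ker, map_smul, h a ha]⟩) f.hom
  obtain rfl : π.shortComplexKer.f ≫ ModuleCat.ofHom g = f := ModuleCat.hom_ext hg
  rw [← Ext.mk₀_comp_mk₀, hS.extClass_comp_assoc]

/-- If quotients of injective modules have vanishing `Ext¹(T, -)`, then `T` has projective
dimension at most one. -/
theorem hasProjectiveDimensionLE_one_of_quotient {T : ModuleCat.{u} R}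
    (h : ∀ (E : Type u) [AddCommGroup E] [Module R E], Module.Injective R E →
      ∀ N : Submodule R E, Subsingleton (Ext.{u} T (ModuleCat.of R (E ⧸ N)) 1)) :
    HasProjectiveDimensionLE T 1 := by
  refine hasProjectiveDimensionLT_of_enoughInjectives T 2 fun M ↦ ?_
  let E := Injective.under M
  let i : M →ₗ[R] E := (Injective.ι M).hom
  have hi : Injective (ModuleCat.of R E) := inferInstanceAs (Injective (Injective.under M))
  have hE : Module.Injective R E := Module.injective_module_of_injective_object R E
  let S : ShortComplex (ModuleCat.{u} R) := ModuleCat.shortComplexOfCompEqZero i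
    (LinearMap.range i).mkQ (LinearMap.range_mkQ_comp i)
  have hS : S.ShortExact := ModuleCat.shortComplex_shortExact S
    (LinearMap.exact_map_mkQ_range i) ((ModuleCat.mono_iff_injective (Injective.ι M)).1 inferInstance)
    (Submodule.mkQ_surjective _)
  have : Injective S.X₂ := hi
  have := h E hE (LinearMap.range i)
  refine subsingleton_of_forall_eq 0 fun x ↦ ?_
  -- Dimension shift: `Ext²(T, E) = 0`, so every class in `Ext²(T, M)` comes from `Ext¹(T, E ⧸ M)`.
  obtain ⟨y, rfl⟩ := Ext.covariant_sequence_exact₁ (S := S) T hS x (Ext.eq_zero_of_injective _)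
    (one_add_one_eq_two)
  rw [Subsingleton.elim (α := Ext.{u} T (ModuleCat.of R (E ⧸ LinearMap.range i)) 1) y 0,
    Ext.zero_comp]

/-- If `φ`-torsion modules have projective dimension at most one, quotients of strongly
nonnil-injective modules are strongly nonnil-injective. -/
theorem IsStronglyNonnilInjective.quotient
    (h : ∀ T : ModuleCat.{u} R, IsPhiTorsion R T → HasProjectiveDimensionLE T 1)
    {E : Type u} [AddCommGroup E] [Module R E] (hE : IsStronglyNonnilInjective R E)
    (N : Submodule R E) : IsStronglyNonnilInjective R (E ⧸ N) := fun T hT n hn ↦ by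
  have hS := LinearMap.shortExact_shortComplexKer N.mkQ_surjective
  have := h T hT
  have := hE T hT n hn
  refine subsingleton_of_forall_eq 0 fun x ↦ ?_
  -- The next term `Ext^(n+1)(T, N)` vanishes because `n + 1 ≥ 2`.
  obtain ⟨y, rfl⟩ := Ext.covariant_sequence_exact₃ T hS x rfl
    (Ext.eq_zero_of_hasProjectiveDimensionLT _ 2 (by lia))
  rw [Subsingleton.elim (α := Ext.{u} T (ModuleCat.of R E) n) y 0, Ext.zero_comp]

/-- All `φ`-torsion modules have projective dimension at most one iff nonnil ideals are
projective. -/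
theorem forall_hasProjectiveDimensionLE_one_iff :
    (∀ T : ModuleCat.{u} R, IsPhiTorsion R T → HasProjectiveDimensionLE T 1) ↔
      ∀ I : Ideal R, IsNonnil I → Module.Projective R I := by
  refine ⟨fun h I hI ↦ ?_, fun h T hT ↦ ?_⟩
  · have hS := LinearMap.shortExact_shortComplexKer I.mkQ_surjective
    have h₂ : Projective I.mkQ.shortComplexKer.X₂ :=
      (IsProjective.iff_projective (R := R) R).1 inferInstance
    have h₁ := (hS.hasProjectiveDimensionLT_X₃_iff 0 h₂).1
      (h (ModuleCat.of R (R ⧸ I)) (isPhiTorsion_quotient hI))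
    have := (IsProjective.iff_projective (R := R) (LinearMap.ker I.mkQ)).2
      (projective_iff_hasProjectiveDimensionLT_one.2 h₁)
    exact Module.Projective.of_equiv' (LinearEquiv.ofEq _ _ I.ker_mkQ)
  · refine hasProjectiveDimensionLE_one_of_quotient fun E _ _ hE N ↦
      subsingleton_ext_one_of_forall_isNonnil (fun I hI g ↦ ?_) hT
    have := h I hI
    obtain ⟨k, hk⟩ := Module.projective_lifting_property N.mkQ g N.mkQ_surjective
    obtain ⟨k', hk'⟩ := hE.out I.subtype I.injective_subtype k
    refine ⟨N.mkQ ∘ₗ k', LinearMap.ext fun x ↦ ?_⟩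
    rw [← hk]
    exact congrArg N.mkQ (hk' x)

end Homological

/-! ### Resolutions of length at most one -/

section GlobalDimension

variable {R : Type u} [CommRing R]

theorem phiInjectiveDimension_le_one_iff {M : Type u} [AddCommGroup M] [Module R M] :
    phiInjectiveDimension R M ≤ 1 ↔ ∃ n ≤ 1, HasPhiInjectiveResolution R M n := by
  refine ⟨fun h ↦ ?_, fun ⟨n, hn, h⟩ ↦ iInf₂_le_of_le n h (by exact_mod_cast hn)⟩
  by_contra! H
  have : (2 : ℕ∞) ≤ phiInjectiveDimension R M := le_iInf₂ fun n hn ↦ by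
    have : 1 < n := lt_of_not_ge fun h ↦ H n h hn
    exact_mod_cast this
  exact absurd (this.trans h) (by decide)

theorem isStronglyNonnilInjective_of_subsingleton (M : Type u) [AddCommGroup M] [Module R M]
    [Subsingleton M] : IsStronglyNonnilInjective R M :=
  have : Module.Injective R M := ⟨fun _ _ _ _ _ _ _ _ _ ↦ ⟨0, fun _ ↦ Subsingleton.elim _ _⟩⟩
  isStronglyNonnilInjective_of_injective M

theorem hasPhiInjectiveResolution_one {E : Type u} [AddCommGroup E] [Module R E]
    (hE : IsStronglyNonnilInjective R E) {M : Type u} [AddCommGroup M] [Module R M]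
    (i : M →ₗ[R] E) (hi : Function.Injective i)
    (hQ : IsStronglyNonnilInjective R (E ⧸ LinearMap.range i)) :
    HasPhiInjectiveResolution R M 1 := by
  refine ⟨fun n ↦ match n with
    | 0 => ModuleCat.of R E
    | 1 => ModuleCat.of R (E ⧸ LinearMap.range i)
    | _ + 2 => ModuleCat.of R PUnit, i, fun n ↦ match n with
    | 0 => (LinearMap.range i).mkQ
    | _ + 1 => 0, hi, LinearMap.exact_map_mkQ_range i, fun n ↦ ?_, fun n hn ↦ ?_, fun n hn ↦ ?_⟩
  · match n with
    | 0 => exact fun x ↦ iff_of_true rfl (Submodule.mkQ_surjective _ x)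
    | n + 1 => exact fun x ↦ iff_of_true rfl ⟨0, rfl⟩
  · match n, hn with
    | 0, _ => exact hE
    | 1, _ => exact hQ
  · match n, hn with
    | n + 2, _ => exact inferInstanceAs (Subsingleton PUnit)

/-- Length `0` is covered by taking `E₁ = 0`, which is strongly nonnil-injective; surjectivity of
`p` is exactness at `E 1`, since `E 2 = 0`. -/
theorem HasPhiInjectiveResolution.exists_exact {M : Type u} [AddCommGroup M] [Module R M]
    {n : ℕ} (h : HasPhiInjectiveResolution R M n) (hn : n ≤ 1) :
    ∃ (E₀ E₁ : ModuleCat.{u} R) (i : M →ₗ[R] E₀) (p : E₀ →ₗ[R] E₁), Function.Injective i ∧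
      Function.Exact i p ∧ Function.Surjective p ∧ IsStronglyNonnilInjective R E₀ ∧
      IsStronglyNonnilInjective R E₁ := by
  obtain ⟨E, i, d, hi, hid, hd, hE, h0⟩ := h
  refine ⟨E 0, E 1, i, d 0, hi, hid, fun x ↦ ?_, hE 0 (Nat.zero_le n), ?_⟩
  · have := h0 2 (by lia)
    exact (hd 0 x).1 (Subsingleton.elim _ _)
  · rcases hn.lt_or_eq with hn | rfl
    · have := h0 1 hn
      exact isStronglyNonnilInjective_of_subsingleton (E 1)
    · exact hE 1 le_rfl

/-- `Ext²(T, M)` sits between `Ext¹(T, E₁)` and `Ext²(T, E₀)`. Both vanish because strong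
nonnil-injectivity covers every positive degree. -/
theorem hasProjectiveDimensionLE_one_of_phiGlobalDimension_le (h : phiGlobalDimension R ≤ 1)
    {T : ModuleCat.{u} R} (hT : IsPhiTorsion R T) : HasProjectiveDimensionLE T 1 := by
  refine hasProjectiveDimensionLT_of_enoughInjectives T 2 fun M ↦ ?_
  obtain ⟨n, hn, hM⟩ := phiInjectiveDimension_le_one_iff.1 ((le_iSup _ M).trans h)
  obtain ⟨E₀, E₁, i, p, hi, hip, hp, hE₀, hE₁⟩ := hM.exists_exact hn
  let S : ShortComplex (ModuleCat.{u} R) :=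
    ModuleCat.shortComplexOfCompEqZero i p hip.linearMap_comp_eq_zero
  have hS : S.ShortExact := ModuleCat.shortComplex_shortExact S hip hi hp
  have h₀ : Subsingleton (Ext.{u} T S.X₂ 2) := hE₀ T hT 2 one_le_two
  have h₁ : Subsingleton (Ext.{u} T S.X₃ 1) := hE₁ T hT 1 le_rfl
  refine subsingleton_of_forall_eq 0 fun x ↦ ?_
  obtain ⟨y, rfl⟩ := Ext.covariant_sequence_exact₁ (S := S) T hS x (Subsingleton.elim _ _)
    one_add_one_eq_two
  rw [Subsingleton.elim y 0, Ext.zero_comp]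

theorem phiGlobalDimension_le_one_of_quotient
    (h : ∀ (E : Type u) [AddCommGroup E] [Module R E], Module.Injective R E →
      ∀ N : Submodule R E, IsStronglyNonnilInjective R (E ⧸ N)) :
    phiGlobalDimension R ≤ 1 := by
  refine iSup_le fun M ↦ phiInjectiveDimension_le_one_iff.2 ⟨1, le_rfl, ?_⟩
  let E := Injective.under M
  have hi : Injective (ModuleCat.of R E) := inferInstanceAs (Injective (Injective.under M))
  have hE : Module.Injective R E := Module.injective_module_of_injective_object R E
  exact hasPhiInjectiveResolution_one (isStronglyNonnilInjective_of_injective E)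
    (Injective.ι M).hom ((ModuleCat.mono_iff_injective (Injective.ι M)).1 inferInstance)
    (h E hE _)

end GlobalDimension

end PhiRing

theorem mainTheorem3 (R : Type u) [CommRing R] [PhiRing.IsPhiRing R] :
    List.TFAE [
      PhiRing.phiGlobalDimension R ≤ 1,
      ∀ (E : Type u) [AddCommGroup E] [Module R E], Module.Injective R E →
        ∀ N : Submodule R E, PhiRing.IsStronglyNonnilInjective R (E ⧸ N),
      ∀ (E : Type u) [AddCommGroup E] [Module R E], PhiRing.IsStronglyNonnilInjective R E →
        ∀ N : Submodule R E, PhiRing.IsStronglyNonnilInjective R (E ⧸ N),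
      PhiRing.IsPhiDedekindRing R ∧ PhiRing.IsStrongPhiRing R] := by
  -- The fourth condition becomes the bound on projective dimensions, the form in which it meets the
  -- other three.
  rw [PhiRing.isPhiDedekindRing_and_isStrongPhiRing_iff,
    ← PhiRing.forall_hasProjectiveDimensionLE_one_iff]
  tfae_have 1 → 4 := fun h _ ↦ PhiRing.hasProjectiveDimensionLE_one_of_phiGlobalDimension_le h
  tfae_have 4 → 3 := fun h _ _ _ hE ↦ hE.quotient h
  tfae_have 3 → 2 := fun h E _ _ _ ↦ h E (PhiRing.isStronglyNonnilInjective_of_injective E)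
  tfae_have 2 → 1 := PhiRing.phiGlobalDimension_le_one_of_quotient
  tfae_finish
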